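/- All graphs are finite, simple and undirected. The direct product $\Sigma\times\Gamma$ of graphs $\Sigma$ and $\Gamma$ is the graph with vertex set $V(\Sigma)\times V(\Gamma)$ in which $(u,x)$ and $(v,y)$ are adjacent if and only if $u$ and $v$ are adjacent in $\Sigma$ and $x$ and $y$ are adjacent in $\Gamma$; $K_d$ denotes the complete graph on $d$ vertices. The canonical double cover of $\Gamma$ is $\mathrm{D}(\Gamma)=\Gamma\times K_2$. A graph $\Gamma$ is called stable if $\mathrm{Aut}(\mathrm{D}(\Gamma))\cong\mathrm{Aut}(\Gamma)\times\mathbb{Z}_2$, and unstable otherwise. It is called nontrivially unstable if it is connected, non-bipartite, unstable, and any two distinct vertices of it have different neighborhoods. Lemma 4.3. Let $\Sigma$ be a graph of order $m$ and let $d>2$ be an integer coprime to $m$. If $\Sigma\times K_d$ is nontrivially unstable, then $\Sigma$ is nontrivially unstable. -/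

import Mathlib

namespace GraphStability

/-- The direct product `G × H`: `(u, x) ∼ (v, y)` iff `u ∼ v` in `G` and `x ∼ y` in `H`. -/
def directProduct {V W : Type*} (G : SimpleGraph V) (H : SimpleGraph W) :
    SimpleGraph (V × W) where
  Adj p q := G.Adj p.1 q.1 ∧ H.Adj p.2 q.2
  symm := ⟨fun _ _ h => ⟨h.1.symm, h.2.symm⟩⟩
  loopless := ⟨fun _ h => G.irrefl h.1⟩

/-- The canonical double cover `D(G) = G × K₂`, with vertex set `V × ℤ₂`. -/
def canonicalDoubleCover {V : Type*} (G : SimpleGraph V) : SimpleGraph (V × ZMod 2) :=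
  directProduct G (SimpleGraph.completeGraph (ZMod 2))

/-- `G` is stable if `Aut(D(G)) ≅ Aut(G) × ℤ₂` as groups. The group structure on `G ≃g G` is
composition of automorphisms, and `Multiplicative (ZMod 2)` is the cyclic group of order two. -/
def Stable {V : Type*} (G : SimpleGraph V) : Prop :=
  Nonempty ((canonicalDoubleCover G ≃g canonicalDoubleCover G) ≃*
    (G ≃g G) × Multiplicative (ZMod 2))

/-- A graph is unstable if it is not stable. -/
def Unstable {V : Type*} (G : SimpleGraph V) : Prop :=
  ¬ Stable G

/-- A graph is vertex-determining if distinct vertices have different neighborhoods. -/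
def VertexDetermining {V : Type*} (G : SimpleGraph V) : Prop :=
  ∀ u v : V, u ≠ v → G.neighborSet u ≠ G.neighborSet v

/-- A graph is nontrivially unstable if it is connected, non-bipartite, vertex-determining and
unstable. -/
def NontriviallyUnstable {V : Type*} (G : SimpleGraph V) : Prop :=
  G.Connected ∧ ¬ G.IsBipartite ∧ VertexDetermining G ∧ Unstable G

end GraphStability

/-!
The three graph-theoretic properties other than instability descend from `G × K_d` to `G` along the
first projection, so the point is that stability of `G` forces stability of `G × K_d`.

For a connected non-bipartite graph `G`, the double cover is connected, so each of its automorphisms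
preserves or exchanges the two halves. Up to the exchange it is a *two-fold automorphism*: a pair
`(α, β)` of permutations of the vertices such that `u ∼ v ↔ α u ∼ β v`. Counting shows that `G` is
stable exactly when every two-fold automorphism has `α = β` (`stable_iff`).

A two-fold automorphism of `G × K_d` preserves every graph defined in terms of intersections of
neighborhoods. One of these is a variant of the Cartesian skeleton (`skeleton`), which is connected
when `G` is finite, connected and non-bipartite (`skeleton_connected`), and which turns the direct
product with `K_d` into a Cartesian product: `skeleton (G × K_d) = skeleton G □ K_d`
(`skeleton_directProduct`). The Cartesian product of a connected graph `S` with `K_d`, for `d > 2`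
coprime to the order of `S`, has only the evident automorphisms (`boxProd_top_perm_split`): either
every `K_d`-fibre is mapped to a `K_d`-fibre, or every one is mapped into an `S`-layer, and in the
latter case each `S`-layer is partitioned into `d`-sets, so that `d` divides the order of `S`.

Thus both members of a two-fold automorphism of `G × K_d` split as `α × β` and `α' × β'`. Adjacency
gives `β = β'` and makes `(α, α')` a two-fold automorphism of `G`, whence `α = α'` if `G` is stable.
-/

namespace GraphStability

/-! ### Connectedness of the canonical double cover -/

theorem connected_induction {V : Type*} {G : SimpleGraph V} (hG : G.Connected) {P : V → Prop}
    {r : V} (hr : P r) (h : ∀ u v, G.Adj u v → P u → P v) (v : V) : P v := by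
  obtain ⟨p⟩ := hG.preconnected r v
  induction p with
  | nil => exact hr
  | cons e _ ih => exact ih (h _ _ e hr)

theorem canonicalDoubleCover_adj {V : Type*} {G : SimpleGraph V} {p q : V × ZMod 2} :
    (canonicalDoubleCover G).Adj p q ↔ G.Adj p.1 q.1 ∧ p.2 ≠ q.2 := Iff.rfl

theorem directProduct_top_adj {V W : Type*} {G : SimpleGraph V} {p q : V × W} :
    (directProduct G (SimpleGraph.completeGraph W)).Adj p q ↔ G.Adj p.1 q.1 ∧ p.2 ≠ q.2 := Iff.rfl

theorem zmod_two_ne_add_one (i : ZMod 2) : i ≠ i + 1 := by revert i; decide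

theorem zmod_two_eq_or_eq_add_one (i j : ZMod 2) : i = j ∨ i = j + 1 := by revert i j; decide

theorem exists_reachable_lift {V : Type*} {G : SimpleGraph V} (hG : G.Connected) (u : V)
    (i : ZMod 2) (v : V) : ∃ j, (canonicalDoubleCover G).Reachable (u, i) (v, j) := by
  refine connected_induction hG (P := fun v => ∃ j, (canonicalDoubleCover G).Reachable (u, i) (v, j))
    ⟨i, .refl _⟩ ?_ v
  rintro v w e ⟨j, hj⟩
  exact ⟨j + 1, hj.trans (SimpleGraph.Adj.reachable ⟨e, zmod_two_ne_add_one j⟩)⟩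

theorem reachable_shift {V : Type*} {G : SimpleGraph V} {u v : V} {i j : ZMod 2}
    (h : (canonicalDoubleCover G).Reachable (u, i) (v, j)) :
    (canonicalDoubleCover G).Reachable (u, i + 1) (v, j + 1) :=
  h.map (G' := canonicalDoubleCover G)
    { toFun := fun p => (p.1, p.2 + 1)
      map_rel' := fun {p q} (e : G.Adj p.1 q.1 ∧ p.2 ≠ q.2) =>
        ⟨e.1, fun h' => e.2 (add_right_cancel h')⟩ }

/-- If no vertex `v` has its two lifts joined by a path, then the parity of the lift of `v` lying in
a fixed component is a proper `2`-coloring of `G`. -/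
theorem canonicalDoubleCover_connected {V : Type*} {G : SimpleGraph V} (hG : G.Connected)
    (hb : ¬ G.IsBipartite) : (canonicalDoubleCover G).Connected := by
  classical
  by_cases h : ∃ v, (canonicalDoubleCover G).Reachable (v, 0) (v, 1)
  · obtain ⟨v, hv⟩ := h
    rw [SimpleGraph.connected_iff_exists_forall_reachable]
    refine ⟨(v, 0), fun ⟨w, k⟩ => ?_⟩
    obtain ⟨j, hj⟩ := exists_reachable_lift hG v 0 w
    rcases zmod_two_eq_or_eq_add_one k j with rfl | rfl
    · exact hj
    · have := reachable_shift hj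
      rw [zero_add] at this
      exact hv.trans this
  · exfalso
    apply hb
    obtain ⟨r⟩ := hG.nonempty
    have key : ∀ v w, G.Adj v w → (canonicalDoubleCover G).Reachable (r, 0) (v, 0) →
        ¬ (canonicalDoubleCover G).Reachable (r, 0) (w, 0) := by
      intro v w e h1 h2
      have e' : (canonicalDoubleCover G).Adj (v, 0) (w, 1) := ⟨e, zero_ne_one⟩
      exact h ⟨w, h2.symm.trans (h1.trans e'.reachable)⟩
    have key' : ∀ v w, G.Adj v w → ¬ (canonicalDoubleCover G).Reachable (r, 0) (v, 0) →
        (canonicalDoubleCover G).Reachable (r, 0) (w, 0) := by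
      intro v w e h1
      obtain ⟨j, hj⟩ := exists_reachable_lift hG r 0 v
      have hj1 : j = 1 := by
        rcases zmod_two_eq_or_eq_add_one j 0 with rfl | rfl
        · exact absurd hj h1
        · rfl
      subst hj1
      have e' : (canonicalDoubleCover G).Adj (v, 1) (w, 0) := ⟨e, one_ne_zero⟩
      exact hj.trans e'.reachable
    have c : G.Coloring Bool := SimpleGraph.Coloring.mk
      (fun v => decide ((canonicalDoubleCover G).Reachable (r, 0) (v, 0))) (by
        intro v w e heq
        rw [decide_eq_decide] at heq
        by_cases hv : (canonicalDoubleCover G).Reachable (r, 0) (v, 0)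
        · exact key v w e hv (heq.1 hv)
        · exact hv (heq.2 (key' v w e hv)))
    exact c.colorable

/-! ### Two-fold automorphisms and stability -/

/-- A pair `(α, β)` of permutations is a two-fold automorphism of `G` if `u ∼ v ↔ α u ∼ β v`. -/
def IsTwoFoldAut {V : Type*} (G : SimpleGraph V) (α β : Equiv.Perm V) : Prop :=
  ∀ u v, G.Adj u v ↔ G.Adj (α u) (β v)

theorem IsTwoFoldAut.symm {V : Type*} {G : SimpleGraph V} {α β : Equiv.Perm V}
    (h : IsTwoFoldAut G α β) : IsTwoFoldAut G β α := fun u v => by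
  rw [G.adj_comm u v, G.adj_comm (β u), h v u]

theorem IsTwoFoldAut.neighborSet {V : Type*} {G : SimpleGraph V} {α β : Equiv.Perm V}
    (h : IsTwoFoldAut G α β) (u : V) : G.neighborSet (α u) = β '' G.neighborSet u := by
  ext w
  rw [Equiv.image_eq_preimage_symm, Set.mem_preimage, SimpleGraph.mem_neighborSet,
    SimpleGraph.mem_neighborSet, h u, β.apply_symm_apply]

/-- The automorphism `(u, i) ↦ (α u, i)` for `i = 0` and `(u, i) ↦ (β u, i)` for `i = 1` of the
double cover given by a two-fold automorphism. -/
def IsTwoFoldAut.toIso {V : Type*} {G : SimpleGraph V} {α β : Equiv.Perm V}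
    (h : IsTwoFoldAut G α β) : canonicalDoubleCover G ≃g canonicalDoubleCover G where
  toFun p := (if p.2 = 0 then α p.1 else β p.1, p.2)
  invFun p := (if p.2 = 0 then α.symm p.1 else β.symm p.1, p.2)
  left_inv p := by by_cases hp : p.2 = 0 <;> simp [hp, Prod.ext_iff]
  right_inv p := by by_cases hp : p.2 = 0 <;> simp [hp, Prod.ext_iff]
  map_rel_iff' := by
    rintro ⟨u, i⟩ ⟨v, j⟩
    have hij : ∀ i j : ZMod 2, i ≠ j → (i = 0 ∧ j = 1) ∨ (i = 1 ∧ j = 0) := by decide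
    simp only [canonicalDoubleCover_adj, Equiv.coe_fn_mk]
    refine and_congr_left fun hne => ?_
    rcases hij i j hne with ⟨rfl, rfl⟩ | ⟨rfl, rfl⟩
    · simpa using (h u v).symm
    · simpa using (h.symm u v).symm

/-- The natural homomorphism `Aut(G) × ℤ₂ → Aut(D(G))`. -/
def liftHom {V : Type*} (G : SimpleGraph V) :
    (G ≃g G) × Multiplicative (ZMod 2) →* (canonicalDoubleCover G ≃g canonicalDoubleCover G) where
  toFun s :=
    { toEquiv := Equiv.prodCongr s.1.toEquiv (Equiv.addLeft s.2.toAdd)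
      map_rel_iff' := by
        rintro ⟨u, i⟩ ⟨v, j⟩
        exact and_congr s.1.map_rel_iff (by simp) }
  map_one' := by ext p <;> simp
  map_mul' s t := by ext p <;> simp [add_assoc]

theorem liftHom_apply {V : Type*} (G : SimpleGraph V) (s : G ≃g G) (e : Multiplicative (ZMod 2))
    (p : V × ZMod 2) : liftHom G (s, e) p = (s p.1, e.toAdd + p.2) := rfl

theorem liftHom_injective {V : Type*} [Nonempty V] (G : SimpleGraph V) :
    Function.Injective (liftHom G) := by
  rintro ⟨s, e⟩ ⟨t, f⟩ h
  have h' : ∀ p : V × ZMod 2, (s p.1, e.toAdd + p.2) = (t p.1, f.toAdd + p.2) := fun p =>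
    DFunLike.congr_fun h p
  refine Prod.ext (RelIso.ext fun v => congrArg Prod.fst (h' (v, 0))) ?_
  obtain ⟨v⟩ := ‹Nonempty V›
  exact Multiplicative.toAdd.injective (add_right_cancel (congrArg Prod.snd (h' (v, 0))))

/-- Since the double cover is connected, an automorphism shifts the `ℤ₂`-coordinate by a constant. -/
theorem exists_twoFoldAut_of_iso {V : Type*} {G : SimpleGraph V} (hG : G.Connected)
    (hb : ¬ G.IsBipartite) (φ : canonicalDoubleCover G ≃g canonicalDoubleCover G) :
    ∃ (α β : Equiv.Perm V) (e : ZMod 2), IsTwoFoldAut G α β ∧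
      (∀ v, φ (v, 0) = (α v, e)) ∧ ∀ v, φ (v, 1) = (β v, e + 1) := by
  obtain ⟨r⟩ := hG.nonempty
  set e := (φ (r, 0)).2 with he
  have hz : ∀ a b c d e : ZMod 2, a ≠ b → c ≠ d → c = e + a → d = e + b := by decide
  have hsnd : ∀ p, (φ p).2 = e + p.2 := fun p =>
    connected_induction (canonicalDoubleCover_connected hG hb) (P := fun p => (φ p).2 = e + p.2)
      (r := (r, 0)) (by simp [he])
      (fun p q hpq hp => hz _ _ _ _ _ hpq.2 (φ.map_rel_iff.2 hpq).2 hp) p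
  have bij : ∀ i : ZMod 2, Function.Bijective fun v => (φ (v, i)).1 := by
    intro i
    constructor
    · intro u v huv
      have : φ (u, i) = φ (v, i) := Prod.ext huv (by rw [hsnd, hsnd])
      exact congrArg Prod.fst (φ.injective this)
    · intro w
      obtain ⟨⟨v, j⟩, hv⟩ := φ.surjective (w, e + i)
      have hj : e + j = e + i := by rw [← hsnd (v, j), hv]
      obtain rfl := add_left_cancel hj
      exact ⟨v, by simp [hv]⟩
  refine ⟨Equiv.ofBijective _ (bij 0), Equiv.ofBijective _ (bij 1), e, fun u v => ?_,
    fun v => Prod.ext rfl (by simpa using hsnd (v, 0)), fun v => Prod.ext rfl (hsnd (v, 1))⟩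
  have h1 := φ.map_rel_iff (a := (u, 0)) (b := (v, 1))
  have h2 : e ≠ e + 1 := zmod_two_ne_add_one e
  simp only [canonicalDoubleCover_adj, hsnd] at h1
  simpa [h2] using h1.symm

theorem liftHom_surjective {V : Type*} {G : SimpleGraph V} (hG : G.Connected)
    (hb : ¬ G.IsBipartite) (h : ∀ α β, IsTwoFoldAut G α β → α = β) :
    Function.Surjective (liftHom G) := by
  intro φ
  obtain ⟨α, β, e, hαβ, h0, h1⟩ := exists_twoFoldAut_of_iso hG hb φ
  obtain rfl := h α β hαβ
  refine ⟨(⟨α, fun {u v} => (hαβ u v).symm⟩, Multiplicative.ofAdd e), RelIso.ext ?_⟩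
  rintro ⟨v, i⟩
  rw [liftHom_apply]
  rcases zmod_two_eq_or_eq_add_one i 0 with rfl | rfl
  · rw [h0]
    simp
  · rw [zero_add, h1]
    simp

/-- Both `Aut(D(G))` and `Aut(G) × ℤ₂` are finite, so an abstract isomorphism between them forces
the natural embedding `liftHom` to be onto. -/
theorem stable_iff {V : Type*} [Finite V] {G : SimpleGraph V} (hG : G.Connected)
    (hb : ¬ G.IsBipartite) : Stable G ↔ ∀ α β, IsTwoFoldAut G α β → α = β := by
  have := hG.nonempty
  constructor
  · rintro ⟨f⟩ α β h
    have : Finite (canonicalDoubleCover G ≃g canonicalDoubleCover G) := DFunLike.finite _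
    have : Finite ((G ≃g G) × Multiplicative (ZMod 2)) := Finite.of_equiv _ f.toEquiv
    have hbij := (Nat.bijective_iff_injective_and_card (liftHom G)).2
      ⟨liftHom_injective G, (Nat.card_congr f.toEquiv).symm⟩
    obtain ⟨⟨s, e⟩, hs⟩ := hbij.2 h.toIso
    ext v
    have h0 : liftHom G (s, e) (v, 0) = h.toIso (v, 0) := by rw [hs]
    have h1 : liftHom G (s, e) (v, 1) = h.toIso (v, 1) := by rw [hs]
    have h0' : s v = α v := congrArg Prod.fst h0
    have h1' : s v = β v := congrArg Prod.fst h1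
    rw [← h0', h1']
  · intro h
    exact ⟨(MulEquiv.ofBijective (liftHom G)
      ⟨liftHom_injective G, liftHom_surjective hG hb h⟩).symm⟩

/-! ### The skeleton -/

/-- The common neighborhood of two vertices. -/
def commonNbrs {V : Type*} (G : SimpleGraph V) (u v : V) : Set V :=
  G.neighborSet u ∩ G.neighborSet v

theorem mem_commonNbrs {V : Type*} {G : SimpleGraph V} {u v w : V} :
    w ∈ commonNbrs G u v ↔ G.Adj u w ∧ G.Adj v w := Iff.rfl

theorem commonNbrs_comm {V : Type*} (G : SimpleGraph V) (u v : V) :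
    commonNbrs G u v = commonNbrs G v u := Set.inter_comm _ _

/-- Two distinct vertices with a common neighbor are joined in the skeleton unless some third vertex
`w` has strictly larger common neighborhoods with both of them. This is
the Cartesian skeleton of Hammack and Imrich with a simpler criterion for dispensing with an edge:
their alternative, a chain `N(u) ⊂ N(w) ⊂ N(v)`, is not needed when one factor is `K_d`, because the
neighborhoods in `K_d` form an antichain. -/
def skeleton {V : Type*} (G : SimpleGraph V) : SimpleGraph V where
  Adj u v := u ≠ v ∧ (commonNbrs G u v).Nonempty ∧
    ¬ ∃ w, commonNbrs G u v ⊂ commonNbrs G u w ∧ commonNbrs G u v ⊂ commonNbrs G v w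
  symm := ⟨fun u v h => by
    refine ⟨h.1.symm, commonNbrs_comm G u v ▸ h.2.1, ?_⟩
    rintro ⟨w, h1, h2⟩
    exact h.2.2 ⟨w, commonNbrs_comm G v u ▸ h2, commonNbrs_comm G v u ▸ h1⟩⟩
  loopless := ⟨fun _ h => h.1 rfl⟩

theorem skeleton_adj {V : Type*} {G : SimpleGraph V} {u v : V} :
    (skeleton G).Adj u v ↔ u ≠ v ∧ (commonNbrs G u v).Nonempty ∧
    ¬ ∃ w, commonNbrs G u v ⊂ commonNbrs G u w ∧ commonNbrs G u v ⊂ commonNbrs G v w := Iff.rfl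

theorem IsTwoFoldAut.commonNbrs {V : Type*} {G : SimpleGraph V} {α β : Equiv.Perm V}
    (h : IsTwoFoldAut G α β) (u v : V) :
    commonNbrs G (α u) (α v) = β '' commonNbrs G u v := by
  unfold GraphStability.commonNbrs
  rw [h.neighborSet, h.neighborSet, Set.image_inter β.injective]

theorem IsTwoFoldAut.skeleton_adj_iff {V : Type*} {G : SimpleGraph V} {α β : Equiv.Perm V}
    (h : IsTwoFoldAut G α β) (u v : V) :
    (skeleton G).Adj (α u) (α v) ↔ (skeleton G).Adj u v := by
  rw [skeleton_adj, skeleton_adj, α.surjective.exists]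
  simp only [h.commonNbrs, Set.image_nonempty, ssubset_iff_subset_not_subset,
    Set.image_subset_image_iff β.injective, α.injective.ne_iff]

/-- An edge of the Boolean square which is absent from the skeleton can be replaced by two edges
with strictly larger common neighborhoods. -/
theorem skeleton_reachable_of_commonNbrs {V : Type*} [Finite V] (G : SimpleGraph V) {u v : V}
    (h : (commonNbrs G u v).Nonempty) : (skeleton G).Reachable u v := by
  generalize hs : commonNbrs G u v = s
  induction s using WellFoundedGT.induction generalizing u v with
  | ind s ih =>
    subst hs
    by_cases huv : u = v
    · exact huv ▸ .refl _
    by_cases hw : ∃ w, commonNbrs G u v ⊂ commonNbrs G u w ∧ commonNbrs G u v ⊂ commonNbrs G v w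
    · obtain ⟨w, h1, h2⟩ := hw
      exact (ih _ h1 (h.mono h1.subset) rfl).trans (ih _ h2 (h.mono h2.subset) rfl).symm
    · exact SimpleGraph.Adj.reachable (skeleton_adj.2 ⟨huv, h, hw⟩)

theorem skeleton_connected {V : Type*} [Finite V] {G : SimpleGraph V} (hG : G.Connected)
    (hb : ¬ G.IsBipartite) : (skeleton G).Connected := by
  rw [SimpleGraph.connected_iff_exists_forall_reachable]
  obtain ⟨r⟩ := hG.nonempty
  refine ⟨r, fun v => ?_⟩
  -- Paths in the double cover starting at `(r, 0)` reach the vertices at even distance in layer `0`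
  -- and those at odd distance in layer `1`.
  have := connected_induction (canonicalDoubleCover_connected hG hb)
    (P := fun p => (p.2 = 0 → (skeleton G).Reachable r p.1) ∧
      (p.2 = 1 → ∀ w, G.Adj p.1 w → (skeleton G).Reachable r w))
    (r := (r, 0)) ⟨fun _ => .refl _, fun h => absurd h zero_ne_one⟩ (by
      rintro ⟨u, i⟩ ⟨v, j⟩ ⟨huv, hij⟩ ⟨h0, h1⟩
      have hij' : ∀ i j : ZMod 2, i ≠ j → (i = 0 ∧ j = 1) ∨ (i = 1 ∧ j = 0) := by decide
      rcases hij' i j hij with ⟨rfl, rfl⟩ | ⟨rfl, rfl⟩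
      · refine ⟨fun h => absurd h one_ne_zero, fun _ w hvw => ?_⟩
        exact (h0 rfl).trans (skeleton_reachable_of_commonNbrs G ⟨v, huv, hvw.symm⟩)
      · exact ⟨fun _ => h1 rfl v huv, fun h => absurd h zero_ne_one⟩) (v, 0)
  exact this.1 rfl

/-! ### The skeleton of a direct product with a complete graph -/

theorem mem_commonNbrs_product {V W : Type*} {G : SimpleGraph V} {p q r : V × W} :
    r ∈ commonNbrs (directProduct G (SimpleGraph.completeGraph W)) p q ↔
      r.1 ∈ commonNbrs G p.1 q.1 ∧ p.2 ≠ r.2 ∧ q.2 ≠ r.2 := by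
  simp only [mem_commonNbrs, directProduct_top_adj]
  tauto

theorem exists_ne_ne_of_two_lt {d : ℕ} (hd : 2 < d) (x y : Fin d) : ∃ z, x ≠ z ∧ y ≠ z := by
  obtain ⟨z, hz⟩ := Finset.exists_mem_notMem_of_card_lt_card
    (s := {x, y}) (t := Finset.univ) (lt_of_le_of_lt Finset.card_le_two (by simpa using hd))
  refine ⟨z, ?_⟩
  simp only [Finset.mem_insert, Finset.mem_singleton, not_or] at hz
  exact ⟨Ne.symm hz.2.1, Ne.symm hz.2.2⟩

/-- Common neighborhoods in `G × K_d` are products, so their containment can be tested in each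
factor. -/
theorem commonNbrs_product_subset_iff {V : Type*} {d : ℕ} (hd : 2 < d) {G : SimpleGraph V}
    {a b a' b' : V} {x y x' y' : Fin d} (hne : (commonNbrs G a b).Nonempty) :
    commonNbrs (directProduct G (SimpleGraph.completeGraph (Fin d))) (a, x) (b, y) ⊆
      commonNbrs (directProduct G (SimpleGraph.completeGraph (Fin d))) (a', x') (b', y') ↔
    commonNbrs G a b ⊆ commonNbrs G a' b' ∧ (x' = x ∨ x' = y) ∧ (y' = x ∨ y' = y) := by
  obtain ⟨w, hw⟩ := hne
  obtain ⟨z, hz⟩ := exists_ne_ne_of_two_lt hd x y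
  constructor
  · intro h
    refine ⟨fun c hc => ?_, ?_, ?_⟩
    · exact (mem_commonNbrs_product.1 (h (a := (c, z)) (mem_commonNbrs_product.2 ⟨hc, hz⟩))).1
    · by_contra! hx
      exact (mem_commonNbrs_product.1
        (h (a := (w, x')) (mem_commonNbrs_product.2 ⟨hw, hx.1.symm, hx.2.symm⟩))).2.1 rfl
    · by_contra! hx
      exact (mem_commonNbrs_product.1
        (h (a := (w, y')) (mem_commonNbrs_product.2 ⟨hw, hx.1.symm, hx.2.symm⟩))).2.2 rfl
  · rintro ⟨h, hx, hy⟩ ⟨c, t⟩ hc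
    rw [mem_commonNbrs_product] at hc ⊢
    refine ⟨h hc.1, ?_, ?_⟩
    · rcases hx with rfl | rfl
      exacts [hc.2.1, hc.2.2]
    · rcases hy with rfl | rfl
      exacts [hc.2.1, hc.2.2]

theorem skeleton_directProduct {V : Type*} {d : ℕ} (hd : 2 < d) {G : SimpleGraph V}
    (hvd : VertexDetermining G) (hiso : ∀ u, (G.neighborSet u).Nonempty) :
    skeleton (directProduct G (SimpleGraph.completeGraph (Fin d))) = (skeleton G) □ ⊤ := by
  ext ⟨u, x⟩ ⟨v, y⟩
  have self : ∀ u, commonNbrs G u u = G.neighborSet u := fun u => Set.inter_self _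
  have left : ∀ u v, commonNbrs G u v ⊆ G.neighborSet u := fun u v => Set.inter_subset_left
  have right : ∀ u v, commonNbrs G u v ⊆ G.neighborSet v := fun u v => Set.inter_subset_right
  have hne : (commonNbrs (directProduct G (SimpleGraph.completeGraph (Fin d))) (u, x)
      (v, y)).Nonempty ↔ (commonNbrs G u v).Nonempty := by
    constructor
    · rintro ⟨r, hr⟩
      exact ⟨r.1, (mem_commonNbrs_product.1 hr).1⟩
    · rintro ⟨w, hw⟩
      obtain ⟨z, hz⟩ := exists_ne_ne_of_two_lt hd x y
      exact ⟨(w, z), mem_commonNbrs_product.2 ⟨hw, hz⟩⟩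
  rw [skeleton_adj, SimpleGraph.boxProd_adj, hne, skeleton_adj]
  simp only [SimpleGraph.top_adj, ssubset_iff_subset_not_subset]
  by_cases hN : (commonNbrs G u v).Nonempty
  swap
  · have huv : u ≠ v := by
      rintro rfl
      exact hN (self u ▸ hiso u)
    simp [hN, huv]
  have sub := fun {a' b' : V} {x' y' : Fin d} =>
    commonNbrs_product_subset_iff hd (a := u) (b := v) (a' := a') (b' := b') (x := x) (y := y)
      (x' := x') (y' := y') hN
  have sub' : ∀ {a' b' : V} {x' y' : Fin d}, commonNbrs G u v ⊆ commonNbrs G a' b' → _ :=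
    fun {a' b'} {x' y'} h =>
    commonNbrs_product_subset_iff hd (a := a') (b := b') (a' := u) (b' := v) (x := x') (y := y')
      (x' := x) (y' := y) (hN.mono h)
  by_cases huv : u = v
  · subst huv
    by_cases hxy : x = y
    · simp [hxy]
    · simp only [ne_eq, Prod.mk.injEq, hxy, and_false, not_false_eq_true, hN, true_and, not_true,
        false_and, and_true, or_true, iff_true]
      rintro ⟨⟨w, z⟩, ⟨h1, h1'⟩, h2, h2'⟩
      have s1 := sub.1 h1
      have s2 := sub.1 h2
      rw [sub' s1.1] at h1'
      rw [sub' s2.1] at h2'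
      have : commonNbrs G u w ⊆ commonNbrs G u u := self u ▸ left u w
      grind
  · by_cases hxy : x = y
    · subst hxy
      simp only [ne_eq, Prod.mk.injEq, huv, not_false_eq_true, hN, true_and, and_true, not_true,
        and_false, or_false]
      refine not_congr ⟨?_, ?_⟩
      · rintro ⟨⟨w, z⟩, ⟨h1, h1'⟩, h2, h2'⟩
        have s1 := sub.1 h1
        have s2 := sub.1 h2
        rw [sub' s1.1] at h1'
        rw [sub' s2.1] at h2'
        exact ⟨w, by grind⟩
      · rintro ⟨w, ⟨h1, h1'⟩, h2, h2'⟩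
        refine ⟨(w, x), ⟨sub.2 ⟨h1, by simp⟩, ?_⟩, sub.2 ⟨h2, by simp⟩, ?_⟩
        · rw [sub' h1]; tauto
        · rw [sub' h2]; tauto
    · -- Of the two remaining corners `(v, x)` and `(u, y)` of the square, the first one makes the
      -- diagonal dispensable unless `N(v) ⊆ N(u)`, and the second one unless `N(u) ⊆ N(v)`.
      simp only [ne_eq, Prod.mk.injEq, huv, hxy, and_false, not_false_eq_true, hN,
        true_and, or_false, iff_false, not_not]
      by_cases hvu : G.neighborSet v ⊆ G.neighborSet u
      · have hnot : ¬ G.neighborSet u ⊆ G.neighborSet v := fun h =>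
          hvd u v huv (h.antisymm hvu)
        have s1 : commonNbrs G u v ⊆ commonNbrs G u u := self u ▸ left u v
        have s2 : commonNbrs G u v ⊆ commonNbrs G v u := (commonNbrs_comm G u v).subset
        refine ⟨(u, y), ⟨sub.2 ⟨s1, by simp⟩, ?_⟩, sub.2 ⟨s2, by simp⟩, ?_⟩
        · rw [sub' s1, self]
          exact fun h => hnot (h.1.trans (right u v))
        · rw [sub' s2]
          tauto
      · have s1 : commonNbrs G u v ⊆ commonNbrs G u v := subset_rfl
        have s2 : commonNbrs G u v ⊆ commonNbrs G v v := self v ▸ right u v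
        refine ⟨(v, x), ⟨sub.2 ⟨s1, by simp⟩, ?_⟩, sub.2 ⟨s2, by simp⟩, ?_⟩
        · rw [sub' s1]
          tauto
        · rw [sub' s2, self]
          exact fun h => hvu (h.1.trans (left u v))

/-! ### Automorphisms of a Cartesian product with a complete graph -/

/-- A clique of a Cartesian product lies in a single layer of one of the two kinds. -/
theorem boxProd_clique {V W ι : Type*} {S : SimpleGraph V} {T : SimpleGraph W} {f : ι → V × W}
    (hf : ∀ i j, i ≠ j → (S □ T).Adj (f i) (f j)) :
    (∀ i j, (f i).1 = (f j).1) ∨ ∀ i j, (f i).2 = (f j).2 := by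
  have hf' : ∀ i j, i ≠ j → ((f i).2 = (f j).2 ∧ (f i).1 ≠ (f j).1) ∨
      ((f i).1 = (f j).1 ∧ (f i).2 ≠ (f j).2) := by
    intro i j hij
    rcases SimpleGraph.boxProd_adj.1 (hf i j hij) with h | h
    · exact .inl ⟨h.2, h.1.ne⟩
    · exact .inr ⟨h.2, h.1.ne⟩
  by_cases h : ∃ i j, i ≠ j ∧ (f i).1 = (f j).1
  · obtain ⟨i, j, hij, h⟩ := h
    have : ∀ k, (f k).1 = (f i).1 := by
      intro k
      have h3 := hf' i j hij
      by_cases hki : k = i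
      · rw [hki]
      by_cases hkj : k = j
      · rw [hkj, h]
      have h1 := hf' k i hki
      have h2 := hf' k j hkj
      grind
    exact .inl fun k l => (this k).trans (this l).symm
  · refine .inr fun i j => ?_
    by_cases hij : i = j
    · rw [hij]
    · exact ((hf' i j hij).resolve_right fun h' => h ⟨i, j, hij, h'.1⟩).1

theorem boxProd_top_fibre {V : Type*} {d : ℕ} {S : SimpleGraph V}
    {ψ : Equiv.Perm (V × Fin d)}
    (hψ : ∀ p q, (S □ (⊤ : SimpleGraph (Fin d))).Adj (ψ p) (ψ q) ↔ (S □ ⊤).Adj p q) (u : V) :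
    (∀ x y, (ψ (u, x)).1 = (ψ (u, y)).1) ∨ ∀ x y, (ψ (u, x)).2 = (ψ (u, y)).2 :=
  boxProd_clique (S := S) (T := ⊤) (f := fun x => ψ (u, x)) fun x y hxy => by
    rw [hψ, SimpleGraph.boxProd_adj_right]
    exact hxy

/-- Neighboring `K_d`-fibres are matched to each other, so if the first is mapped to a `K_d`-fibre
then the second cannot be mapped into an `S`-layer. -/
theorem boxProd_top_fibre_step {V : Type*} {d : ℕ} (hd : 2 < d) {S : SimpleGraph V}
    {ψ : Equiv.Perm (V × Fin d)}
    (hψ : ∀ p q, (S □ (⊤ : SimpleGraph (Fin d))).Adj (ψ p) (ψ q) ↔ (S □ ⊤).Adj p q) {u v : V}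
    (huv : S.Adj u v) (hu : ∀ x y, (ψ (u, x)).1 = (ψ (u, y)).1) :
    ∀ x y, (ψ (v, x)).1 = (ψ (v, y)).1 := by
  refine (boxProd_top_fibre hψ v).resolve_right fun hv => ?_
  have x₀ : Fin d := ⟨0, by omega⟩
  set c := (ψ (v, x₀)).2 with hc
  have inj : ∀ x y, (ψ (u, x)).2 = (ψ (u, y)).2 → x = y := fun x y h =>
    congrArg Prod.snd (ψ.injective (Prod.ext (hu x y) h))
  have inj' : ∀ x y, (ψ (v, x)).1 = (ψ (v, y)).1 → x = y := fun x y h =>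
    congrArg Prod.snd (ψ.injective (Prod.ext h (hv x y)))
  have hadj : ∀ x, (ψ (u, x)).2 ≠ c → (ψ (u, x)).1 = (ψ (v, x)).1 := by
    intro x hx
    have := (hψ (u, x) (v, x)).2 (SimpleGraph.boxProd_adj_left.2 huv)
    rcases SimpleGraph.boxProd_adj.1 this with h | h
    · exact absurd (h.2.trans (hv x x₀)) hx
    · exact h.2
  -- Two indices `x ≠ y` avoiding the one, if any, at which the second coordinate equals `c`.
  obtain ⟨x, y, hxy, hx, hy⟩ : ∃ x y, x ≠ y ∧ (ψ (u, x)).2 ≠ c ∧ (ψ (u, y)).2 ≠ c := by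
    by_cases h : ∃ z, (ψ (u, z)).2 = c
    · obtain ⟨z, hz⟩ := h
      obtain ⟨x, hx, -⟩ := exists_ne_ne_of_two_lt hd z z
      obtain ⟨y, hy, hy'⟩ := exists_ne_ne_of_two_lt hd z x
      exact ⟨x, y, hy', fun h => hx (inj _ _ (hz.trans h.symm)),
        fun h => hy (inj _ _ (hz.trans h.symm))⟩
    · push Not at h
      obtain ⟨y, hy, -⟩ := exists_ne_ne_of_two_lt hd x₀ x₀
      exact ⟨x₀, y, hy, h _, h _⟩
  exact hxy (inj' x y (by rw [← hadj x hx, ← hadj y hy, hu x y]))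

/-- If every `K_d`-fibre is mapped into an `S`-layer, then a fixed `S`-layer is the disjoint union of
the images of `K_d`-fibres. -/
theorem dvd_card_of_fibres_snd {V : Type*} [Finite V] {d : ℕ} (hd : 0 < d)
    {ψ : Equiv.Perm (V × Fin d)} (h : ∀ u x y, (ψ (u, x)).2 = (ψ (u, y)).2) :
    d ∣ Nat.card V := by
  let x₀ : Fin d := ⟨0, hd⟩
  let e₁ : {p : V × Fin d // p.2 = x₀} ≃ V :=
    ⟨fun p => p.1.1, fun v => ⟨(v, x₀), rfl⟩, fun p => Subtype.ext (Prod.ext rfl p.2.symm),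
      fun _ => rfl⟩
  let e₂ : {p : V × Fin d // (ψ p).2 = x₀} ≃ {p : V × Fin d // p.2 = x₀} :=
    ψ.subtypeEquiv fun _ => Iff.rfl
  let e₃ : {p : V × Fin d // (ψ p).2 = x₀} ≃ {u : V // (ψ (u, x₀)).2 = x₀} × Fin d :=
    ⟨fun p => (⟨p.1.1, (h p.1.1 x₀ p.1.2).trans p.2⟩, p.1.2),
      fun p => ⟨(p.1.1, p.2), (h p.1.1 p.2 x₀).trans p.1.2⟩, fun _ => rfl, fun _ => rfl⟩
  have := Nat.card_congr ((e₁.symm.trans e₂.symm).trans e₃)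
  rw [Nat.card_prod, Nat.card_fin] at this
  exact this ▸ dvd_mul_left _ _

theorem boxProd_top_perm_split {V : Type*} [Finite V] {d : ℕ} (hd : 2 < d) {S : SimpleGraph V}
    (hS : S.Connected) (hcop : Nat.Coprime d (Nat.card V)) {ψ : Equiv.Perm (V × Fin d)}
    (hψ : ∀ p q, (S □ (⊤ : SimpleGraph (Fin d))).Adj (ψ p) (ψ q) ↔ (S □ ⊤).Adj p q) :
    ∃ (α : Equiv.Perm V) (β : Equiv.Perm (Fin d)), ∀ p, ψ p = (α p.1, β p.2) := by
  have x₀ : Fin d := ⟨0, by omega⟩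
  have hfst : ∀ u x y, (ψ (u, x)).1 = (ψ (u, y)).1 := by
    by_cases h : ∃ u, ∀ x y, (ψ (u, x)).1 = (ψ (u, y)).1
    · obtain ⟨u, hu⟩ := h
      exact connected_induction hS (P := fun u => ∀ x y, (ψ (u, x)).1 = (ψ (u, y)).1) hu
        fun _ _ e => boxProd_top_fibre_step hd hψ e
    · push Not at h
      exfalso
      have hdvd := dvd_card_of_fibres_snd (by omega) fun u =>
        (boxProd_top_fibre hψ u).resolve_left fun h' => by
          obtain ⟨x, y, hxy⟩ := h u
          exact hxy (h' x y)
      have := Nat.Coprime.eq_one_of_dvd hcop hdvd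
      omega
  have inj : ∀ u, Function.Injective fun x => (ψ (u, x)).2 := fun u x y h =>
    congrArg Prod.snd (ψ.injective (Prod.ext (hfst u x y) h))
  have injα : Function.Injective fun u => (ψ (u, x₀)).1 := by
    intro u v huv
    obtain ⟨x, hx⟩ := Finite.surjective_of_injective (inj u) (ψ (v, x₀)).2
    exact congrArg Prod.fst (ψ.injective (Prod.ext ((hfst u x x₀).trans huv) hx) :
      (u, x) = (v, x₀))
  obtain ⟨r⟩ := hS.nonempty
  have hsnd : ∀ u x, (ψ (u, x)).2 = (ψ (r, x)).2 := fun u =>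
    connected_induction hS (P := fun u => ∀ x, (ψ (u, x)).2 = (ψ (r, x)).2) (fun _ => rfl)
      (fun u v e hu x => by
        have := (hψ (u, x) (v, x)).2 (SimpleGraph.boxProd_adj_left.2 e)
        rcases SimpleGraph.boxProd_adj.1 this with h | h
        · rw [← h.2, hu x]
        · exact absurd (injα ((hfst u x₀ x).trans (h.2.trans (hfst v x x₀)))) e.ne) u
  exact ⟨Equiv.ofBijective _ (Finite.injective_iff_bijective.1 injα),
    Equiv.ofBijective _ (Finite.injective_iff_bijective.1 (inj r)),
    fun ⟨u, x⟩ => Prod.ext (hfst u x x₀) (hsnd u x)⟩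

/-! ### Stability of the product -/

theorem exists_adj_of_not_isBipartite {V : Type*} {G : SimpleGraph V} (hG : G.Connected)
    (hb : ¬ G.IsBipartite) (u : V) : (G.neighborSet u).Nonempty := by
  have : Nontrivial V := by
    by_contra h
    rw [not_nontrivial_iff_subsingleton] at h
    exact hb ⟨SimpleGraph.Coloring.mk (fun _ => 0) fun {v w} e => (e.ne (Subsingleton.elim v w)).elim⟩
  exact hG.preconnected.exists_adj_of_nontrivial u

theorem stable_directProduct {V : Type*} [Finite V] {d : ℕ} (hd : 2 < d) {G : SimpleGraph V}
    (hcop : Nat.Coprime d (Nat.card V)) (hG : G.Connected) (hb : ¬ G.IsBipartite)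
    (hvd : VertexDetermining G) (hs : Stable G)
    (hG' : (directProduct G (SimpleGraph.completeGraph (Fin d))).Connected)
    (hb' : ¬ (directProduct G (SimpleGraph.completeGraph (Fin d))).IsBipartite) :
    Stable (directProduct G (SimpleGraph.completeGraph (Fin d))) := by
  rw [stable_iff hG hb] at hs
  rw [stable_iff hG' hb']
  have hiso := exists_adj_of_not_isBipartite hG hb
  have split : ∀ φ φ', IsTwoFoldAut (directProduct G (SimpleGraph.completeGraph (Fin d))) φ φ' →
      ∃ (α : Equiv.Perm V) (β : Equiv.Perm (Fin d)), ∀ p, φ p = (α p.1, β p.2) := by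
    intro φ φ' h
    refine boxProd_top_perm_split hd (skeleton_connected hG hb) hcop fun p q => ?_
    rw [← skeleton_directProduct hd hvd hiso]
    exact h.skeleton_adj_iff p q
  intro φ φ' h
  obtain ⟨α, β, hφ⟩ := split φ φ' h
  obtain ⟨α', β', hφ'⟩ := split φ' φ h.symm
  have key : ∀ u v x y, G.Adj u v ∧ x ≠ y ↔ G.Adj (α u) (α' v) ∧ β x ≠ β' y := by
    intro u v x y
    simpa only [directProduct_top_adj, hφ, hφ'] using h (u, x) (v, y)
  have x₀ : Fin d := ⟨0, by omega⟩
  have hβ : ∀ x, β x = β' x := by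
    intro x
    obtain ⟨u⟩ := hG.nonempty
    obtain ⟨v, huv⟩ := hiso u
    obtain ⟨y, hy, -⟩ := exists_ne_ne_of_two_lt hd x x
    have h1 := ((key u v x y).1 ⟨huv, hy⟩).1
    by_contra hne
    exact ((key u v x x).2 ⟨h1, hne⟩).2 rfl
  have hα : α = α' := by
    refine hs α α' fun u v => ?_
    obtain ⟨y, hy, -⟩ := exists_ne_ne_of_two_lt hd x₀ x₀
    have := key u v x₀ y
    rw [← hβ y] at this
    simpa [hy] using this
  ext1 p
  rw [hφ, hφ', hα, hβ]

end GraphStability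

open GraphStability in
theorem lemma4p3 {V : Type*} [Finite V] (G : SimpleGraph V) (m d : ℕ)
    (hm : Nat.card V = m) (hd : 2 < d) (hdm : Nat.Coprime d m)
    (h : GraphStability.NontriviallyUnstable
      (GraphStability.directProduct G (SimpleGraph.completeGraph (Fin d)))) :
    GraphStability.NontriviallyUnstable G := by
  subst hm
  obtain ⟨hG', hb', hvd', hu'⟩ := h
  have x₀ : Fin d := ⟨0, by omega⟩
  let f : directProduct G (SimpleGraph.completeGraph (Fin d)) →g G := ⟨Prod.fst, fun e => e.1⟩
  have hG : G.Connected := hG'.map f fun v => ⟨(v, x₀), rfl⟩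
  have hb : ¬ G.IsBipartite := fun hc => hb' (hc.of_hom f)
  have hvd : VertexDetermining G := by
    intro u v huv hN
    refine hvd' (u, x₀) (v, x₀) (fun h => huv (congrArg Prod.fst h)) ?_
    ext ⟨w, z⟩
    have : G.Adj u w ↔ G.Adj v w := Set.ext_iff.1 hN w
    simp only [SimpleGraph.mem_neighborSet, directProduct_top_adj, this]
  exact ⟨hG, hb, hvd, fun hs => hu' (stable_directProduct hd hdm hG hb hvd hs hG' hb')⟩
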